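/- Let $X_1,\dots,X_n$ be independent random variables, $X_k$ having law $\mu_k$ on a measurable space $D_k$, and let $\mu=\mu_1\otimes\cdots\otimes\mu_n$. Let $A_1,\dots,A_m\subseteq\prod_k D_k$ be (measurable) bad events, where membership in $A_i$ is determined by the variables with index in $\mathrm{vbl}(A_i)\subseteq\{1,\dots,n\}$. For $S\subseteq\{1,\dots,m\}$ put $\mathrm{vbl}(S)=\bigcup_{i\in S}\mathrm{vbl}(A_i)$ and $\partial S=\{i\notin S:\ \mathrm{vbl}(A_i)\cap\mathrm{vbl}(A_j)\ne\emptyset\text{ for some }j\in S\}$. For an assignment $\sigma\in\prod_kD_k$ put $\mathrm{Bad}(\sigma)=\{i:\sigma\in A_i\}$, and write $A_i\cap\sigma_S=\emptyset$ if $\mathrm{vbl}(A_i)\cap\mathrm{vbl}(S)=\emptyset$ or no $\tau\in A_i$ agrees with $\sigma$ on $\mathrm{vbl}(A_i)\cap\mathrm{vbl}(S)$. The resampling set $\mathrm{Res}(\sigma)$ is computed as follows. Start with $R=\mathrm{Bad}(\sigma)$ and $N=\emptyset$. While $\partial R\setminus N\neq\emptyset$, do a round: simultaneously for all $i\in\partial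 R\setminus N$ (with $R$ as it is at the beginning of the round), add $i$ to $R$ if $A_i\cap\sigma_R\ne\emptyset$, and add $i$ to $N$ otherwise. When the loop ends, $\mathrm{Res}(\sigma)=R$. Assume that for every $S$ the set $\{\sigma:\mathrm{Res}(\sigma)=S\}$ is $\mu$-measurable, that is, measurable up to a $\mu$-null set (this is automatic, for example, when every $D_k$ is finite or countable with all subsets measurable). General partial rejection sampling is the following algorithm. Draw independent samples of all variables from their laws. While at least one bad event occurs under the current assignment $\sigma$, compute $\mathrm{Res}(\sigma)$ and replace the values of all variables in $\mathrm{vbl}(\mathrm{Res}(\sigma))$ by fresh independent samples from their laws. When no bad event occurs, output the current assignment. **Theorem.** If the algorithm halts, then its output has the product distribution conditioned on none of the $A_i$ occurring. That is, the set on which the algorithm halts is an event (up to a null set), and if it has positive probability, then $\mu\big(\bigcap_i\overline{A_i}\big)>0$ and the conditional law of the output, given that the algorithm halts, is $\mu\big(\,\cdot\mid\bigcap_i\overline{A_i}\big)$. -/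

import Mathlib

/-- An instance of the variable framework with variables indexed by `Fin n` (the `k`-th one with
range `D k`) and bad events indexed by `Fin m`. An event is a set of assignments, and membership
in `event j` is determined by the values of the variables in `vbl j`. -/
structure VariableFramework {n : ℕ} (D : Fin n → Type*) (m : ℕ) where
  event : Fin m → Set (∀ k, D k)
  vbl : Fin m → Finset (Fin n)
  dependsOn_vbl : ∀ j, DependsOn (fun σ : ∀ k, D k => σ ∈ event j) (vbl j : Set (Fin n))

namespace VariableFramework

variable {n m : ℕ} {D : Fin n → Type*} (I : VariableFramework D m)

/-- The dependency graph: distinct events are adjacent iff they share a variable. -/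
def depGraph : SimpleGraph (Fin m) where
  Adj i j := i ≠ j ∧ (I.vbl i ∩ I.vbl j).Nonempty
  symm := ⟨fun i j h => ⟨h.1.symm, by rw [Finset.inter_comm]; exact h.2⟩⟩
  loopless := ⟨fun _ h => h.1 rfl⟩

/-- The variables of a set of events. -/
def vblSet (S : Finset (Fin m)) : Finset (Fin n) := S.biUnion I.vbl

open Classical in
/-- The bad events that occur under the assignment `σ`. -/
noncomputable def bad (σ : ∀ k, D k) : Finset (Fin m) :=
  Finset.univ.filter fun i => σ ∈ I.event i

open Classical in
/-- The boundary `∂S` of a set of events in the dependency graph. -/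
noncomputable def boundary (S : Finset (Fin m)) : Finset (Fin m) :=
  Finset.univ.filter fun i => i ∉ S ∧ ∃ j ∈ S, I.depGraph.Adj i j

/-- `A_i ∩ σ_S = ∅`: either `A_i` shares no variable with `S`, or no assignment in `A_i` agrees
with `σ` on the shared variables. -/
def DisjointPartial (i : Fin m) (σ : ∀ k, D k) (S : Finset (Fin m)) : Prop :=
  I.vbl i ∩ I.vblSet S = ∅ ∨
    ¬ ∃ τ ∈ I.event i, ∀ k ∈ I.vbl i ∩ I.vblSet S, τ k = σ k

open Classical in
/-- The loop selecting the resampling set, from the current sets `R` (resampling) and `N` (not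
resampling). One pass treats all of `∂R \ N` simultaneously, against the partial assignment on
the set `R` held at the beginning of the pass. -/
noncomputable def selectLoop (σ : ∀ k, D k) (R N : Finset (Fin m)) : Finset (Fin m) :=
  if I.boundary R \ N = ∅ then R
  else
    selectLoop σ
      (R ∪ (I.boundary R \ N).filter fun i => ¬ I.DisjointPartial i σ R)
      (N ∪ (I.boundary R \ N).filter fun i => I.DisjointPartial i σ R)
termination_by ((R ∪ N)ᶜ).card
decreasing_by
  rename_i hne
  obtain ⟨i, hi⟩ := Finset.nonempty_iff_ne_empty.mpr hne
  have hi' := hi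
  simp only [boundary, Finset.mem_sdiff, Finset.mem_filter, Finset.mem_univ, true_and] at hi'
  refine Finset.card_lt_card ((Finset.ssubset_iff_of_subset ?_).mpr ⟨i, ?_, ?_⟩)
  · intro x hx
    simp only [Finset.mem_compl, Finset.mem_union, not_or] at hx ⊢
    exact ⟨hx.1.1, hx.2.1⟩
  · simp only [Finset.mem_compl, Finset.mem_union, not_or]
    exact ⟨hi'.1.1, hi'.2⟩
  · by_cases h : I.DisjointPartial i σ R <;>
      simp [-Finset.mem_sdiff, hi, h]

/-- The resampling set `Res(σ)`. -/
noncomputable def res (σ : ∀ k, D k) : Finset (Fin m) := I.selectLoop σ (I.bad σ) ∅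

/-- General partial rejection sampling. `X t k` is the fresh sample of the variable `k` that is
available in round `t`; `I.run X t` is the assignment after `t` rounds of resampling, and it stays
unchanged once no bad event occurs. -/
noncomputable def run (X : ℕ → ∀ k, D k) : ℕ → ∀ k, D k
  | 0 => X 0
  | t + 1 =>
    if I.bad (run X t) = ∅ then run X t
    else fun k => if k ∈ I.vblSet (I.res (run X t)) then X (t + 1) k else run X t k

/-- The algorithm halts when driven by the samples `X`. -/
def Halts (X : ℕ → ∀ k, D k) : Prop := ∃ t, I.bad (I.run X t) = ∅

/-- The output of the algorithm: the assignment at the first time when no bad event occurs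
(only meaningful when the algorithm halts). -/
noncomputable def output (X : ℕ → ∀ k, D k) : ∀ k, D k :=
  I.run X (sInf {t | I.bad (I.run X t) = ∅})

/-- The assignments that avoid all bad events. -/
def good : Set (∀ k, D k) := {σ | ∀ i, σ ∉ I.event i}

end VariableFramework

/-! ### Locality of the resampling set -/

namespace VariableFramework

variable {n m : ℕ} {D : Fin n → Type*} (I : VariableFramework D m)

/-! The invariant (`IsMixture`): after every round the law of the assignment is a nonnegative
combination of restrictions of the product measure to the sets `avoidOutside S`. Initially `S` is
everything and there is no restriction.

One round preserves it. Fix `S` and let `Res(σ) = S`. Then `σ` lies in `avoidOutside S`, a set that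
does not depend on `vbl(S)`. Conversely, any `τ` in `avoidOutside S` that agrees with `σ` on
`vbl(S)` has the same bad events and the same resampling set (`bad_eq_of_agree`, `res_eq_of_agree`).
So, outside `vbl(S)`, the selection reveals only membership in `avoidOutside S`, and fresh values on
`vbl(S)` give a multiple of the product measure on `avoidOutside S`
(`exists_lintegral_piecewise_eq_mul`).

Every `avoidOutside S` contains `good`, so on `good` each law of the invariant is a multiple of the
product measure. Stopping makes the events "in `B ∩ good` at time `t`" increase with `t`; their
limit is "halts with output in `B`", and normalising gives the theorem. -/

/-- The assignments avoiding every event outside the closed neighbourhood of `S`. -/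
def avoidOutside (S : Finset (Fin m)) : Set (∀ k, D k) :=
  {σ | ∀ i, i ∉ S → i ∉ I.boundary S → σ ∉ I.event i}

variable {I}

theorem mem_bad {σ : ∀ k, D k} {i : Fin m} : i ∈ I.bad σ ↔ σ ∈ I.event i := by
  simp [bad]

theorem mem_boundary {S : Finset (Fin m)} {i : Fin m} :
    i ∈ I.boundary S ↔ i ∉ S ∧ ∃ j ∈ S, I.depGraph.Adj i j := by
  simp [boundary]

theorem mem_vblSet {S : Finset (Fin m)} {k : Fin n} :
    k ∈ I.vblSet S ↔ ∃ i ∈ S, k ∈ I.vbl i := by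
  simp [vblSet]

theorem vblSet_mono {S T : Finset (Fin m)} (h : S ⊆ T) : I.vblSet S ⊆ I.vblSet T :=
  Finset.biUnion_subset_biUnion_of_subset_left _ h

theorem vbl_inter_vblSet_ne_empty {S : Finset (Fin m)} {i : Fin m} (h : i ∈ I.boundary S) :
    I.vbl i ∩ I.vblSet S ≠ ∅ := by
  obtain ⟨-, j, hj, -, k, hk⟩ := mem_boundary.1 h
  rw [Finset.mem_inter] at hk
  exact Finset.ne_empty_of_mem (Finset.mem_inter.2 ⟨hk.1, mem_vblSet.2 ⟨j, hj, hk.2⟩⟩)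

theorem mem_event_congr {σ τ : ∀ k, D k} {i : Fin m} (h : ∀ k ∈ I.vbl i, σ k = τ k) :
    σ ∈ I.event i ↔ τ ∈ I.event i :=
  iff_of_eq (I.dependsOn_vbl i fun k hk => h k hk)

theorem disjointPartial_congr {σ τ : ∀ k, D k} {S : Finset (Fin m)}
    (h : ∀ k ∈ I.vblSet S, σ k = τ k) (i : Fin m) :
    I.DisjointPartial i σ S ↔ I.DisjointPartial i τ S := by
  have key : ∀ ρ : ∀ k, D k, (∀ k ∈ I.vbl i ∩ I.vblSet S, ρ k = σ k) ↔
      ∀ k ∈ I.vbl i ∩ I.vblSet S, ρ k = τ k := fun ρ =>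
    forall₂_congr fun k hk => by rw [h k (Finset.mem_inter.1 hk).2]
  simp only [DisjointPartial, key]

/-- An event meeting the variables of `S` that is disjoint from the partial assignment on a
subset of `S` does not occur. -/
theorem notMem_event_of_disjointPartial {σ τ : ∀ k, D k} {R S : Finset (Fin m)} {i : Fin m}
    (hR : R ⊆ S) (hi : I.vbl i ∩ I.vblSet R ≠ ∅) (hd : I.DisjointPartial i σ R)
    (h : ∀ k ∈ I.vblSet S, τ k = σ k) : τ ∉ I.event i := fun hτ =>
  (hd.resolve_left hi) ⟨τ, hτ, fun k hk => h k (vblSet_mono hR (Finset.mem_inter.1 hk).2)⟩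

theorem subset_selectLoop (σ : ∀ k, D k) (R N : Finset (Fin m)) : R ⊆ I.selectLoop σ R N := by
  induction R, N using selectLoop.induct I σ with
  | case1 R N h => rw [selectLoop, if_pos h]
  | case2 R N h ih =>
    rw [selectLoop, if_neg h]
    exact Finset.subset_union_left.trans ih

-- Each pass consults the assignment only on the variables of the current `R`, which is contained in
-- the final set.
open Classical in
theorem selectLoop_congr {σ τ : ∀ k, D k} (R N : Finset (Fin m))
    (h : ∀ k ∈ I.vblSet (I.selectLoop σ R N), τ k = σ k) :
    I.selectLoop τ R N = I.selectLoop σ R N := by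
  induction R, N using selectLoop.induct I σ with
  | case1 R N hR => rw [selectLoop.eq_1 I τ, selectLoop.eq_1 I σ, if_pos hR, if_pos hR]
  | case2 R N hR ih =>
    have hcongr : ∀ i, I.DisjointPartial i τ R ↔ I.DisjointPartial i σ R :=
      disjointPartial_congr fun k hk => h k (vblSet_mono (subset_selectLoop σ R N) hk)
    rw [selectLoop, if_neg hR] at h
    rw [selectLoop.eq_1 I τ, selectLoop.eq_1 I σ, if_neg hR, if_neg hR]
    have hR' : (I.boundary R \ N).filter (fun i => ¬ I.DisjointPartial i τ R) =
        (I.boundary R \ N).filter fun i => ¬ I.DisjointPartial i σ R :=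
      Finset.filter_congr fun i _ => not_congr (hcongr i)
    have hN' : (I.boundary R \ N).filter (fun i => I.DisjointPartial i τ R) =
        (I.boundary R \ N).filter fun i => I.DisjointPartial i σ R :=
      Finset.filter_congr fun i _ => hcongr i
    rw [hR', hN']
    exact ih h

-- At termination the boundary lies in `N`, and each member of `N` was rejected against the values
-- on some earlier `R'`, which `τ` shares. The hypothesis `hN` is the loop invariant; nonempty
-- intersection rules out the trivial alternative in `DisjointPartial`.
open Classical in
theorem notMem_event_of_mem_boundary_selectLoop {σ τ : ∀ k, D k} (R N : Finset (Fin m))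
    (hN : ∀ i ∈ N, ∃ R' ⊆ R, I.vbl i ∩ I.vblSet R' ≠ ∅ ∧ I.DisjointPartial i σ R')
    (h : ∀ k ∈ I.vblSet (I.selectLoop σ R N), τ k = σ k) {i : Fin m}
    (hi : i ∈ I.boundary (I.selectLoop σ R N)) : τ ∉ I.event i := by
  induction R, N using selectLoop.induct I σ with
  | case1 R N hR =>
    rw [selectLoop, if_pos hR] at hi h
    obtain ⟨R', hR', hv, hd⟩ := hN i (Finset.sdiff_eq_empty_iff_subset.1 hR hi)
    exact notMem_event_of_disjointPartial hR' hv hd h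
  | case2 R N hR ih =>
    rw [selectLoop, if_neg hR] at hi h
    refine ih ?_ h hi
    intro j hj
    rcases Finset.mem_union.1 hj with hj | hj
    · obtain ⟨R', hR', h'⟩ := hN j hj
      exact ⟨R', hR'.trans Finset.subset_union_left, h'⟩
    · simp only [Finset.mem_filter, Finset.mem_sdiff] at hj
      exact ⟨R, Finset.subset_union_left, vbl_inter_vblSet_ne_empty hj.1.1, hj.2⟩

theorem bad_subset_res (σ : ∀ k, D k) : I.bad σ ⊆ I.res σ := subset_selectLoop σ _ _

/-- Events in `Res(σ)` see only shared values, boundary events are excluded by those values, and the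
remaining ones by `hτ`. -/
theorem bad_eq_of_agree {σ τ : ∀ k, D k} (h : ∀ k ∈ I.vblSet (I.res σ), τ k = σ k)
    (hτ : τ ∈ I.avoidOutside (I.res σ)) : I.bad τ = I.bad σ := by
  ext i
  rw [mem_bad, mem_bad]
  by_cases hi : i ∈ I.res σ
  · exact mem_event_congr fun k hk => h k (mem_vblSet.2 ⟨i, hi, hk⟩)
  · refine iff_of_false ?_ fun hσ => hi (bad_subset_res σ (mem_bad.2 hσ))
    by_cases hb : i ∈ I.boundary (I.res σ)
    · exact notMem_event_of_mem_boundary_selectLoop (I.bad σ) ∅ (by simp) h hb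
    · exact hτ i hi hb

theorem res_eq_of_agree {σ τ : ∀ k, D k} (h : ∀ k ∈ I.vblSet (I.res σ), τ k = σ k)
    (hτ : τ ∈ I.avoidOutside (I.res σ)) : I.res τ = I.res σ := by
  rw [res, bad_eq_of_agree h hτ]
  exact selectLoop_congr _ _ h

theorem mem_avoidOutside_res (σ : ∀ k, D k) : σ ∈ I.avoidOutside (I.res σ) :=
  fun _ hi _ hσ => hi (bad_subset_res σ (mem_bad.2 hσ))

/-- An event outside `S` and its boundary shares no variable with `S`. -/
theorem mem_avoidOutside_congr {σ τ : ∀ k, D k} {S : Finset (Fin m)}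
    (h : ∀ k, k ∉ I.vblSet S → σ k = τ k) : σ ∈ I.avoidOutside S ↔ τ ∈ I.avoidOutside S := by
  refine forall_congr' fun i => forall_congr' fun hi => forall_congr' fun hb => ?_
  refine not_congr (mem_event_congr fun k hk => h k fun hkS => hb ?_)
  obtain ⟨j, hj, hkj⟩ := mem_vblSet.1 hkS
  exact mem_boundary.2
    ⟨hi, j, hj, fun hij => hi (hij ▸ hj), k, Finset.mem_inter.2 ⟨hk, hkj⟩⟩

/-! ### Runs, halting and output -/

theorem mem_good_iff {σ : ∀ k, D k} : σ ∈ I.good ↔ I.bad σ = ∅ := by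
  simp [good, Finset.eq_empty_iff_forall_notMem, mem_bad]

theorem boundary_empty : I.boundary ∅ = ∅ := by
  simp [boundary]

theorem good_subset_avoidOutside (S : Finset (Fin m)) : I.good ⊆ I.avoidOutside S :=
  fun _ hσ i _ _ => hσ i

theorem avoidOutside_univ : I.avoidOutside Finset.univ = Set.univ := by
  simp [avoidOutside]

theorem res_eq_empty_of_bad_eq_empty {σ : ∀ k, D k} (h : I.bad σ = ∅) : I.res σ = ∅ := by
  rw [res, selectLoop, h, if_pos (by simp [boundary_empty])]

/-- Stopping amounts to resampling the empty set, so one formula covers both branches. -/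
theorem run_succ (X : ℕ → ∀ k, D k) (t : ℕ) :
    I.run X (t + 1) =
      (I.vblSet (I.res (I.run X t))).piecewise (X (t + 1)) (I.run X t) := by
  rw [run]
  split_ifs with h
  · rw [res_eq_empty_of_bad_eq_empty h, vblSet, Finset.biUnion_empty, Finset.piecewise_empty]
  · rfl

theorem run_eq_run {X : ℕ → ∀ k, D k} {s t : ℕ} (hst : s ≤ t) (h : I.bad (I.run X s) = ∅) :
    I.run X t = I.run X s := by
  induction t, hst using Nat.le_induction with
  | base => rfl
  | succ t hst ih => rw [run, ih, if_pos h]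

theorem output_eq_run {X : ℕ → ∀ k, D k} {t : ℕ} (h : I.bad (I.run X t) = ∅) :
    I.output X = I.run X t :=
  (run_eq_run (Nat.sInf_le h) (Nat.sInf_mem (s := {t | I.bad (I.run X t) = ∅}) ⟨t, h⟩)).symm

/-- Trades the first halting time for a countable union over fixed times. -/
theorem halts_and_output_mem_iff {X : ℕ → ∀ k, D k} {B : Set (∀ k, D k)} :
    (I.Halts X ∧ I.output X ∈ B) ↔ ∃ t, I.run X t ∈ B ∩ I.good := by
  constructor
  · rintro ⟨⟨t, ht⟩, hB⟩
    exact ⟨t, output_eq_run ht ▸ hB, mem_good_iff.2 ht⟩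
  · rintro ⟨t, hB, ht⟩
    rw [mem_good_iff] at ht
    exact ⟨⟨t, ht⟩, (output_eq_run ht).symm ▸ hB⟩

theorem monotone_run_mem_inter_good {Ω : Type*} {X : ℕ → ∀ k, Ω → D k} (B : Set (∀ k, D k)) :
    Monotone fun t => {ω | I.run (fun t k => X t k ω) t ∈ B ∩ I.good} := by
  rintro s t hst ω ⟨hB, hg⟩
  have hrun := run_eq_run hst (mem_good_iff.1 hg)
  exact ⟨hrun.symm ▸ hB, hrun.symm ▸ hg⟩

theorem setOf_halts_eq_iUnion {Ω : Type*} {X : ℕ → ∀ k, Ω → D k} :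
    {ω | I.Halts fun t k => X t k ω} =
      ⋃ t, {ω | I.run (fun t k => X t k ω) t ∈ I.good} := by
  ext ω
  simp [Halts, mem_good_iff]

end VariableFramework

/-! ### Resampling coordinates of a product measure -/

open MeasureTheory in
theorem measurePreserving_piecewise_swap {ι : Type*} [Fintype ι] [DecidableEq ι] {D : ι → Type*}
    [∀ k, MeasurableSpace (D k)] (μ : ∀ k, Measure (D k)) [∀ k, IsProbabilityMeasure (μ k)]
    (V : Finset ι) :
    MeasurePreserving (fun p : (∀ k, D k) × (∀ k, D k) => (V.piecewise p.2 p.1, V.piecewise p.1 p.2))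
      ((Measure.pi μ).prod (Measure.pi μ)) ((Measure.pi μ).prod (Measure.pi μ)) := by
  have hpw : ∀ {f g : (∀ k, D k) × (∀ k, D k) → ∀ k, D k}, Measurable f → Measurable g →
      Measurable fun p => V.piecewise (f p) (g p) := by
    intro f g hf hg
    refine measurable_pi_iff.2 fun k => ?_
    by_cases hk : k ∈ V
    · simpa [hk] using measurable_pi_iff.1 hf k
    · simpa [hk] using measurable_pi_iff.1 hg k
  have hmeas := (hpw measurable_snd measurable_fst).prodMk (hpw measurable_fst measurable_snd)
  refine ⟨hmeas, ?_⟩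
  have span : (Measure.pi μ).FiniteSpanningSetsIn
      (Set.univ.pi '' Set.univ.pi fun i => {s : Set (D i) | MeasurableSet s}) :=
    { set := fun _ => Set.univ
      set_mem := fun _ => ⟨fun _ => Set.univ, fun _ _ => MeasurableSet.univ, by simp⟩
      finite := fun _ => measure_lt_top _ _
      spanning := Set.iUnion_const _ }
  refine (Measure.prod_eq_generateFrom generateFrom_pi generateFrom_pi isPiSystem_pi isPiSystem_pi
    span span ?_).symm
  rintro _ ⟨s, hs, rfl⟩ _ ⟨t, ht, rfl⟩
  have hs' : ∀ k, MeasurableSet (s k) := fun k => hs k trivial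
  have ht' : ∀ k, MeasurableSet (t k) := fun k => ht k trivial
  rw [Measure.map_apply hmeas ((MeasurableSet.univ_pi hs').prod (MeasurableSet.univ_pi ht'))]
  have hpre : (fun p : (∀ k, D k) × (∀ k, D k) =>
        (V.piecewise p.2 p.1, V.piecewise p.1 p.2)) ⁻¹' (Set.univ.pi s ×ˢ Set.univ.pi t) =
      Set.univ.pi (V.piecewise t s) ×ˢ Set.univ.pi (V.piecewise s t) := by
    ext p
    simp only [Set.mem_preimage, Set.mem_prod, Set.mem_univ_pi, ← forall_and]
    refine forall_congr' fun k => ?_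
    by_cases hk : k ∈ V <;> simp [hk, and_comm]
  rw [hpre, Measure.prod_prod, Measure.pi_pi, Measure.pi_pi, Measure.pi_pi, Measure.pi_pi,
    ← Finset.prod_mul_distrib, ← Finset.prod_mul_distrib]
  refine Finset.prod_congr rfl fun k _ => ?_
  by_cases hk : k ∈ V <;> simp [hk, mul_comm]

open MeasureTheory in
/-- If `E` is a cylinder over `V` inside a set `G` not depending on `V`, then resampling the
coordinates in `V` turns the restriction of a product measure to `E` into a multiple of its
restriction to `G`. The cylinder structure is needed only up to a null set. -/
theorem exists_lintegral_piecewise_eq_mul {ι : Type*} [Fintype ι] [DecidableEq ι] {D : ι → Type*}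
    [∀ k, MeasurableSpace (D k)] (μ : ∀ k, Measure (D k)) [∀ k, IsProbabilityMeasure (μ k)]
    (V : Finset ι) {E E₀ G : Set (∀ k, D k)} (hE : MeasurableSet E)
    (hEE₀ : ∀ᵐ σ ∂Measure.pi μ, σ ∈ E ↔ σ ∈ E₀) (hG : MeasurableSet G)
    (hGV : ∀ σ τ : ∀ k, D k, (∀ k, k ∉ V → σ k = τ k) → σ ∈ G → τ ∈ G) (hE₀G : E₀ ⊆ G)
    (hE₀ : ∀ σ ∈ E₀, ∀ τ ∈ G, (∀ k ∈ V, τ k = σ k) → τ ∈ E₀) :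
    ∃ c, ∀ B, MeasurableSet B →
      ∫⁻ σ in E, Measure.pi μ {x | V.piecewise x σ ∈ B} ∂Measure.pi μ =
        c * Measure.pi μ (B ∩ G) := by
  set π := Measure.pi μ
  have hswap := measurePreserving_piecewise_swap μ V
  have hpw : MeasurePreserving (fun p : (∀ k, D k) × (∀ k, D k) => V.piecewise p.2 p.1)
      (π.prod π) π := measurePreserving_fst.comp hswap
  -- The section of `E₀` over `y` is the same for all `y` in `G`; its measure is the constant `c`.
  have hindep : ∀ y ∈ G, ∀ y' ∈ G, ∀ z, V.piecewise z y ∈ E₀ → V.piecewise z y' ∈ E₀ := by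
    intro y _ y' hy' z hz
    refine hE₀ _ hz _ (hGV y' _ (fun k hk => by simp [hk]) hy') fun k hk => by simp [hk]
  obtain ⟨c, hc⟩ : ∃ c, ∀ y, π {z | V.piecewise z y ∈ E₀} = G.indicator (fun _ => c) y := by
    have hout : ∀ y, y ∉ G → π {z | V.piecewise z y ∈ E₀} = 0 := by
      intro y hy
      have : {z | V.piecewise z y ∈ E₀} = ∅ := Set.eq_empty_of_forall_notMem fun z hz =>
        hy (hGV _ y (fun k hk => by simp [hk]) (hE₀G hz))
      rw [this, measure_empty]
    rcases G.eq_empty_or_nonempty with hGe | ⟨y₀, hy₀⟩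
    · exact ⟨0, fun y => by rw [hout y (by simp [hGe])]; simp⟩
    · refine ⟨π {z | V.piecewise z y₀ ∈ E₀}, fun y => ?_⟩
      by_cases hy : y ∈ G
      · rw [Set.indicator_of_mem hy]
        congr 1
        ext z
        exact ⟨hindep y hy y₀ hy₀ z, hindep y₀ hy₀ y hy z⟩
      · rw [Set.indicator_of_notMem hy, hout y hy]
  refine ⟨c, fun B hB => ?_⟩
  have hA : MeasurableSet {p : (∀ k, D k) × (∀ k, D k) | p.1 ∈ E ∧ V.piecewise p.2 p.1 ∈ B} :=
    (measurable_fst hE).inter (hpw.measurable hB)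
  have hpre : (fun p : (∀ k, D k) × (∀ k, D k) =>
        (V.piecewise p.2 p.1, V.piecewise p.1 p.2)) ⁻¹'
        {p | p.1 ∈ E ∧ V.piecewise p.2 p.1 ∈ B} =
      {p | V.piecewise p.2 p.1 ∈ E ∧ p.1 ∈ B} := by
    ext p
    have : V.piecewise (V.piecewise p.1 p.2) (V.piecewise p.2 p.1) = p.1 := by
      ext k
      by_cases hk : k ∈ V <;> simp [hk]
    simp only [Set.mem_preimage, Set.mem_ofPred_eq, this]
  have hA' : MeasurableSet {p : (∀ k, D k) × (∀ k, D k) | V.piecewise p.2 p.1 ∈ E ∧ p.1 ∈ B} :=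
    (hpw.measurable hE).inter (measurable_fst hB)
  -- Resampling preserves the product measure, so the exceptional null set pulls back to a null set,
  -- and Fubini makes almost every section null.
  have hae : ∀ᵐ y ∂π, π {z | V.piecewise z y ∈ E} = π {z | V.piecewise z y ∈ E₀} := by
    filter_upwards [Measure.ae_ae_of_ae_prod (hpw.quasiMeasurePreserving.ae hEE₀)] with y hy
    exact measure_congr (hy.mono fun z hz => propext hz)
  -- Exchanging the `V`-coordinates of the old and fresh samples makes the resampled assignment the
  -- first component `y`; the condition `E` then falls on `y` with its `V`-coordinates redrawn, an
  -- event of probability `c` or `0`.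
  calc ∫⁻ σ in E, π {x | V.piecewise x σ ∈ B} ∂π
      = (π.prod π) {p | p.1 ∈ E ∧ V.piecewise p.2 p.1 ∈ B} := by
        rw [Measure.prod_apply hA, ← lintegral_indicator hE]
        refine lintegral_congr fun σ => ?_
        by_cases hσ : σ ∈ E <;> simp [hσ]
    _ = (π.prod π) {p | V.piecewise p.2 p.1 ∈ E ∧ p.1 ∈ B} := by
        rw [← hpre, hswap.measure_preimage hA.nullMeasurableSet]
    _ = ∫⁻ y, (B ∩ G).indicator (fun _ => c) y ∂π := by
        rw [Measure.prod_apply hA']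
        refine lintegral_congr_ae (hae.mono fun y hy => ?_)
        rw [hc] at hy
        by_cases hyB : y ∈ B
        · by_cases hyG : y ∈ G <;> simpa [hyB, hyG] using hy
        · simp [hyB]
    _ = c * π (B ∩ G) := lintegral_indicator_const (hB.inter hG) c

/-! ### Mixtures and their invariance under one round -/

namespace VariableFramework

open MeasureTheory

variable {n m : ℕ} {D : Fin n → Type*} {I : VariableFramework D m} [∀ k, MeasurableSpace (D k)]

theorem measurableSet_avoidOutside (hEvent : ∀ i, MeasurableSet (I.event i))
    (S : Finset (Fin m)) : MeasurableSet (I.avoidOutside S) := by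
  simp only [avoidOutside, Set.ofPred_forall]
  exact MeasurableSet.iInter fun i => MeasurableSet.iInter fun _ => MeasurableSet.iInter fun _ =>
    (hEvent i).compl

theorem measurableSet_good (hEvent : ∀ i, MeasurableSet (I.event i)) : MeasurableSet I.good := by
  simp only [good, Set.ofPred_forall]
  exact MeasurableSet.iInter fun i => (hEvent i).compl

/-- A measurable version of `Res`, needed to form image measures. -/
theorem exists_measurable_ae_eq_res (μ : Measure (∀ k, D k))
    (hRes : ∀ S, NullMeasurableSet {σ | I.res σ = S} μ) :
    ∃ r : (∀ k, D k) → Finset (Fin m),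
      (∀ S, MeasurableSet {σ | r σ = S}) ∧ ∀ᵐ σ ∂μ, r σ = I.res σ := by
  let _ : MeasurableSpace (Finset (Fin m)) := ⊤
  have : DiscreteMeasurableSpace (Finset (Fin m)) := ⟨fun _ => trivial⟩
  have h : NullMeasurable I.res μ := by
    intro s _
    rw [← Set.biUnion_preimage_singleton]
    exact NullMeasurableSet.biUnion s.to_countable fun S _ => hRes S
  obtain ⟨r, hr, hrr⟩ := h.aemeasurable
  exact ⟨r, fun S => hr (measurableSet_singleton S), hrr.symm⟩

/-- Replacing the variables of `r σ` in `σ` by those of `x`. -/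
def resample (I : VariableFramework D m) (r : (∀ k, D k) → Finset (Fin m)) (x σ : ∀ k, D k) :
    ∀ k, D k :=
  (I.vblSet (r σ)).piecewise x σ

theorem measurable_resample {r : (∀ k, D k) → Finset (Fin m)}
    (hr : ∀ S, MeasurableSet {σ | r σ = S}) {α : Type*} [MeasurableSpace α]
    {x σ : α → ∀ k, D k} (hx : Measurable x) (hσ : Measurable σ) :
    Measurable fun a => I.resample r (x a) (σ a) := by
  refine measurable_pi_iff.2 fun k => ?_
  have hs : MeasurableSet {a | k ∈ I.vblSet (r (σ a))} := by
    have : {a | k ∈ I.vblSet (r (σ a))} =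
        ⋃ S ∈ {S | k ∈ I.vblSet S}, σ ⁻¹' {τ | r τ = S} := by
      ext a
      simp
    rw [this]
    exact MeasurableSet.biUnion (Set.to_countable _) fun S _ => hσ (hr S)
  exact Measurable.ite hs (measurable_pi_iff.1 hx k) (measurable_pi_iff.1 hσ k)

/-- A combination of restrictions of the product measure to the sets `I.avoidOutside S`. -/
def IsMixture (I : VariableFramework D m) (μ : ∀ k, Measure (D k)) (ν : Measure (∀ k, D k)) :
    Prop :=
  ∃ c : Finset (Fin m) → ENNReal, ν = ∑ S, c S • (Measure.pi μ).restrict (I.avoidOutside S)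

variable {μ : ∀ k, Measure (D k)} {ν : Measure (∀ k, D k)}

theorem isMixture_pi : I.IsMixture μ (Measure.pi μ) := by
  classical
  refine ⟨fun S => if S = Finset.univ then 1 else 0, ?_⟩
  rw [Finset.sum_eq_single Finset.univ (fun S _ hS => by simp [hS]) (by simp)]
  simp [avoidOutside_univ]

theorem IsMixture.absolutelyContinuous (h : I.IsMixture μ ν) : ν ≪ Measure.pi μ := by
  obtain ⟨c, rfl⟩ := h
  intro s hs
  rw [Measure.finsetSum_apply]
  refine Finset.sum_eq_zero fun S _ => ?_
  rw [Measure.smul_apply, Measure.restrict_le_self.absolutelyContinuous hs, smul_zero]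

theorem IsMixture.exists_measure_inter_good (h : I.IsMixture μ ν)
    (hEvent : ∀ i, MeasurableSet (I.event i)) :
    ∃ c, ∀ B, MeasurableSet B → ν (B ∩ I.good) = c * Measure.pi μ (B ∩ I.good) := by
  obtain ⟨c, rfl⟩ := h
  refine ⟨∑ S, c S, fun B hB => ?_⟩
  rw [Measure.finsetSum_apply, Finset.sum_mul]
  refine Finset.sum_congr rfl fun S _ => ?_
  rw [Measure.smul_apply, Measure.restrict_apply (hB.inter (measurableSet_good hEvent)),
    Set.inter_eq_left.2 (Set.inter_subset_right.trans (good_subset_avoidOutside S)), smul_eq_mul]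

theorem exists_setLIntegral_resample [∀ k, IsProbabilityMeasure (μ k)]
    (hEvent : ∀ i, MeasurableSet (I.event i)) {r : (∀ k, D k) → Finset (Fin m)}
    (hr : ∀ S, MeasurableSet {σ | r σ = S}) (hrr : ∀ᵐ σ ∂Measure.pi μ, r σ = I.res σ)
    (T S : Finset (Fin m)) :
    ∃ c, ∀ B, MeasurableSet B →
      ∫⁻ σ in {σ | r σ = S} ∩ I.avoidOutside T,
          Measure.pi μ {x | I.resample r x σ ∈ B} ∂Measure.pi μ =
        c * Measure.pi μ (B ∩ I.avoidOutside S) := by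
  have hmeas := (hr S).inter (measurableSet_avoidOutside hEvent T)
  obtain ⟨c, hc⟩ := exists_lintegral_piecewise_eq_mul μ (I.vblSet S) hmeas
    (E₀ := {σ | I.res σ = S} ∩ I.avoidOutside T) (G := I.avoidOutside S)
    (hrr.mono fun σ hσ => by simp [hσ]) (measurableSet_avoidOutside hEvent S)
    (fun σ τ h => (mem_avoidOutside_congr h).1)
    (by rintro σ ⟨rfl, -⟩; exact mem_avoidOutside_res σ)
    -- Membership in `avoidOutside T` is a condition on the bad events alone, and `τ` has the same
    -- ones as `σ`.
    (by
      rintro σ ⟨rfl, hσ⟩ τ hτ h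
      refine ⟨res_eq_of_agree h hτ, fun i hi hb hi' => hσ i hi hb ?_⟩
      rwa [← mem_bad, ← bad_eq_of_agree h hτ, mem_bad])
  refine ⟨c, fun B hB => ?_⟩
  rw [← hc B hB]
  refine setLIntegral_congr_fun hmeas fun σ hσ => ?_
  have : r σ = S := hσ.1
  simp only [resample]
  rw [this]

/-- Splitting by the old component `T` and the value `S` of `r`, the pair contributes a multiple of
the component `S`. -/
theorem IsMixture.map_resample [∀ k, IsProbabilityMeasure (μ k)] [SFinite ν]
    (h : I.IsMixture μ ν) (hEvent : ∀ i, MeasurableSet (I.event i))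
    {r : (∀ k, D k) → Finset (Fin m)} (hr : ∀ S, MeasurableSet {σ | r σ = S})
    (hrr : ∀ᵐ σ ∂Measure.pi μ, r σ = I.res σ) :
    I.IsMixture μ ((ν.prod (Measure.pi μ)).map fun p => I.resample r p.2 p.1) := by
  obtain ⟨a, ha⟩ := h
  choose c hc using exists_setLIntegral_resample hEvent hr hrr
  refine ⟨fun S => ∑ T, a T * c T S, ?_⟩
  have hmeas : Measurable fun p : (∀ k, D k) × (∀ k, D k) => I.resample r p.2 p.1 :=
    measurable_resample hr measurable_snd measurable_fst
  ext B hB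
  rw [Measure.map_apply hmeas hB, Measure.prod_apply (hmeas hB), ha, lintegral_finsetSum_measure,
    Measure.finsetSum_apply]
  have hsplit : ∀ T, ∫⁻ σ in I.avoidOutside T, Measure.pi μ {x | I.resample r x σ ∈ B}
      ∂Measure.pi μ = ∑ S, c T S * Measure.pi μ (B ∩ I.avoidOutside S) := by
    intro T
    have hU : I.avoidOutside T = ⋃ S, {σ | r σ = S} ∩ I.avoidOutside T := by
      ext σ
      simp
    conv_lhs => rw [hU]
    rw [lintegral_iUnion (fun S => (hr S).inter (measurableSet_avoidOutside hEvent T)),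
      tsum_fintype]
    · exact Finset.sum_congr rfl fun S _ => hc T S B hB
    · intro S S' hSS'
      exact Set.disjoint_left.2 fun σ h h' => hSS' (h.1.symm.trans h'.1)
  calc ∑ T, ∫⁻ σ, Measure.pi μ (Prod.mk σ ⁻¹' ((fun p => I.resample r p.2 p.1) ⁻¹' B))
        ∂(a T • (Measure.pi μ).restrict (I.avoidOutside T))
      = ∑ T, ∑ S, a T * c T S * Measure.pi μ (B ∩ I.avoidOutside S) := by
        refine Finset.sum_congr rfl fun T _ => ?_
        rw [lintegral_smul_measure, smul_eq_mul]
        simp only [mul_assoc, ← Finset.mul_sum]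
        exact congrArg _ (hsplit T)
    _ = _ := by
        rw [Finset.sum_comm]
        refine Finset.sum_congr rfl fun S _ => ?_
        rw [Measure.smul_apply, Measure.restrict_apply hB, smul_eq_mul, Finset.sum_mul]

end VariableFramework

/-! ### The random run and its law -/

namespace VariableFramework

open MeasureTheory ProbabilityTheory

variable {n m : ℕ} {D : Fin n → Type*} {I : VariableFramework D m} [∀ k, MeasurableSpace (D k)]
  {μ : ∀ k, Measure (D k)} {Ω : Type*}

/-- The run of the algorithm with `r` in place of the resampling set. -/
def runWith (I : VariableFramework D m) (r : (∀ k, D k) → Finset (Fin m))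
    (X : ℕ → ∀ k, D k) : ℕ → ∀ k, D k
  | 0 => X 0
  | t + 1 => I.resample r (X (t + 1)) (runWith I r X t)

/-- The σ-algebra generated by the samples of the rounds in `T`. -/
abbrev samplesSigma (X : ℕ → ∀ k, Ω → D k) (T : Set ℕ) : MeasurableSpace Ω :=
  ⨆ p ∈ {p : ℕ × Fin n | p.1 ∈ T}, MeasurableSpace.comap (X p.1 p.2) inferInstance

theorem measurable_samplesSigma (X : ℕ → ∀ k, Ω → D k) {T : Set ℕ} {t : ℕ} (ht : t ∈ T) :
    Measurable[samplesSigma X T] fun ω k => X t k ω := by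
  refine @measurable_pi_lambda _ _ _ (samplesSigma X T) _ _ fun k => ?_
  refine Measurable.mono (comap_measurable (X t k)) ?_ le_rfl
  exact le_iSup₂_of_le (t, k) ht le_rfl

theorem measurable_runWith_samplesSigma {r : (∀ k, D k) → Finset (Fin m)}
    (hr : ∀ S, MeasurableSet {σ | r σ = S}) (X : ℕ → ∀ k, Ω → D k) {s t : ℕ} (hts : t ≤ s) :
    Measurable[samplesSigma X (Set.Iic s)] fun ω => I.runWith r (fun t k => X t k ω) t := by
  induction t with
  | zero => exact measurable_samplesSigma X hts
  | succ t ih =>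
    exact @measurable_resample _ _ _ _ _ _ hr _ (samplesSigma X (Set.Iic s)) _ _
      (measurable_samplesSigma X hts) (ih (Nat.le_of_succ_le hts))

variable [MeasurableSpace Ω] {P : Measure Ω} {X : ℕ → ∀ k, Ω → D k}

theorem measurable_runWith {r : (∀ k, D k) → Finset (Fin m)}
    (hr : ∀ S, MeasurableSet {σ | r σ = S}) (hX : ∀ t k, Measurable (X t k)) (t : ℕ) :
    Measurable fun ω => I.runWith r (fun t k => X t k ω) t :=
  (measurable_runWith_samplesSigma hr X le_rfl).mono
    (iSup₂_le fun p _ => (hX p.1 p.2).comap_le) le_rfl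

/-- The assignment at time `t` uses only samples of rounds up to `t`. -/
theorem indepFun_runWith_samples {r : (∀ k, D k) → Finset (Fin m)}
    (hr : ∀ S, MeasurableSet {σ | r σ = S}) (hX : ∀ t k, Measurable (X t k))
    (hIndep : iIndepFun (fun p : ℕ × Fin n => X p.1 p.2) P) (t : ℕ) :
    IndepFun (fun ω => I.runWith r (fun t k => X t k ω) t) (fun ω k => X (t + 1) k ω) P := by
  have h : Indep (samplesSigma X (Set.Iic t)) (samplesSigma X {t + 1}) P := by
    have hd : Disjoint {p : ℕ × Fin n | p.1 ∈ Set.Iic t} {p | p.1 ∈ ({t + 1} : Set ℕ)} := by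
      rw [Set.disjoint_left]
      rintro ⟨s, k⟩ (hs : s ≤ t) (hs' : s = t + 1)
      omega
    exact indep_iSup_of_disjoint
      (m := fun p : ℕ × Fin n => MeasurableSpace.comap (X p.1 p.2) inferInstance)
      (fun p => (hX p.1 p.2).comap_le) hIndep.iIndep hd
  rw [IndepFun_iff_Indep]
  exact indep_of_indep_of_le_right
    (indep_of_indep_of_le_left h (measurable_runWith_samplesSigma hr X le_rfl).comap_le)
    (measurable_samplesSigma X (Set.mem_singleton _)).comap_le

variable [IsProbabilityMeasure P]

theorem map_samples_eq_pi (hX : ∀ t k, Measurable (X t k)) (hLaw : ∀ t k, P.map (X t k) = μ k)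
    (hIndep : iIndepFun (fun p : ℕ × Fin n => X p.1 p.2) P) (t : ℕ) :
    P.map (fun ω k => X t k ω) = Measure.pi μ := by
  have h : iIndepFun (fun k => X t k) P :=
    hIndep.precomp (g := fun k : Fin n => (t, k)) fun _ _ h => (Prod.mk.inj h).2
  rw [(iIndepFun_iff_map_fun_eq_pi_map fun k => (hX t k).aemeasurable).1 h]
  simp only [hLaw]

variable [∀ k, IsProbabilityMeasure (μ k)]

theorem isMixture_map_runWith (hEvent : ∀ i, MeasurableSet (I.event i))
    {r : (∀ k, D k) → Finset (Fin m)} (hr : ∀ S, MeasurableSet {σ | r σ = S})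
    (hrr : ∀ᵐ σ ∂Measure.pi μ, r σ = I.res σ) (hX : ∀ t k, Measurable (X t k))
    (hLaw : ∀ t k, P.map (X t k) = μ k)
    (hIndep : iIndepFun (fun p : ℕ × Fin n => X p.1 p.2) P) (t : ℕ) :
    I.IsMixture μ (P.map fun ω => I.runWith r (fun t k => X t k ω) t) := by
  induction t with
  | zero =>
    have := map_samples_eq_pi hX hLaw hIndep 0
    simp only [runWith]
    rw [this]
    exact isMixture_pi
  | succ t ih =>
    have hZ := measurable_runWith (I := I) hr hX t
    have hXt : Measurable fun ω k => X (t + 1) k ω := measurable_pi_lambda _ fun k => hX _ k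
    have hjoint := (indepFun_runWith_samples (I := I) hr hX hIndep t).map_prod_eq_prod_map_map
      hZ.aemeasurable hXt.aemeasurable
    rw [map_samples_eq_pi hX hLaw hIndep] at hjoint
    have hstep := ih.map_resample hEvent hr hrr
    rwa [← hjoint, Measure.map_map (measurable_resample hr measurable_snd measurable_fst)
      (hZ.prodMk hXt)] at hstep

/-- By the invariant each law is absolutely continuous with respect to the product measure, so the
run almost surely never meets the null set where `r` differs from `Res`. -/
theorem runWith_ae_eq_run (hEvent : ∀ i, MeasurableSet (I.event i))
    {r : (∀ k, D k) → Finset (Fin m)} (hr : ∀ S, MeasurableSet {σ | r σ = S})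
    (hrr : ∀ᵐ σ ∂Measure.pi μ, r σ = I.res σ) (hX : ∀ t k, Measurable (X t k))
    (hLaw : ∀ t k, P.map (X t k) = μ k)
    (hIndep : iIndepFun (fun p : ℕ × Fin n => X p.1 p.2) P) (t : ℕ) :
    ∀ᵐ ω ∂P, I.runWith r (fun t k => X t k ω) t = I.run (fun t k => X t k ω) t := by
  induction t with
  | zero => exact Filter.Eventually.of_forall fun ω => by rw [run, runWith]
  | succ t ih =>
    have hac := (isMixture_map_runWith hEvent hr hrr hX hLaw hIndep t).absolutelyContinuous
    filter_upwards [ih,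
      ae_of_ae_map (measurable_runWith hr hX t).aemeasurable (hac.ae_le hrr)] with ω hω hω'
    rw [run_succ, ← hω, ← hω', runWith, resample]

/-- The law of each assignment is proportional on the good set to the product measure. -/
theorem exists_measure_run_mem_inter_good (hEvent : ∀ i, MeasurableSet (I.event i))
    (hRes : ∀ S, NullMeasurableSet {σ | I.res σ = S} (Measure.pi μ))
    (hX : ∀ t k, Measurable (X t k)) (hLaw : ∀ t k, P.map (X t k) = μ k)
    (hIndep : iIndepFun (fun p : ℕ × Fin n => X p.1 p.2) P) (t : ℕ) :
    AEMeasurable (fun ω => I.run (fun t k => X t k ω) t) P ∧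
      ∃ c, ∀ B, MeasurableSet B →
        P {ω | I.run (fun t k => X t k ω) t ∈ B ∩ I.good} =
          c * Measure.pi μ (B ∩ I.good) := by
  obtain ⟨r, hr, hrr⟩ := exists_measurable_ae_eq_res (Measure.pi μ) hRes
  have hZ := measurable_runWith (I := I) hr hX t
  have hae := runWith_ae_eq_run hEvent hr hrr hX hLaw hIndep t
  refine ⟨hZ.aemeasurable.congr hae, ?_⟩
  obtain ⟨c, hc⟩ :=
    (isMixture_map_runWith hEvent hr hrr hX hLaw hIndep t).exists_measure_inter_good hEvent
  refine ⟨c, fun B hB => ?_⟩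
  rw [← hc B hB, Measure.map_apply hZ (hB.inter (measurableSet_good hEvent))]
  refine measure_congr (Filter.eventuallyEq_set.2 (hae.mono fun ω hω => ?_))
  rw [Set.mem_ofPred_eq, Set.mem_preimage, hω]

/-- The output on the halting event has a law proportional to the restricted product measure. -/
theorem exists_measure_halts_and_output_mem (hEvent : ∀ i, MeasurableSet (I.event i))
    (hRes : ∀ S, NullMeasurableSet {σ | I.res σ = S} (Measure.pi μ))
    (hX : ∀ t k, Measurable (X t k)) (hLaw : ∀ t k, P.map (X t k) = μ k)
    (hIndep : iIndepFun (fun p : ℕ × Fin n => X p.1 p.2) P) :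
    ∃ c, ∀ B, MeasurableSet B →
      P {ω | I.Halts (fun t k => X t k ω) ∧ I.output (fun t k => X t k ω) ∈ B} =
        c * Measure.pi μ (B ∩ I.good) := by
  choose _ c hc using exists_measure_run_mem_inter_good hEvent hRes hX hLaw hIndep
  -- The events increase with `t`, so continuity from below turns the union into a supremum.
  refine ⟨⨆ t, c t, fun B hB => ?_⟩
  simp only [halts_and_output_mem_iff, Set.ofPred_exists]
  rw [(monotone_run_mem_inter_good B).measure_iUnion, ENNReal.iSup_mul]
  exact iSup_congr fun t => hc t B hB

theorem nullMeasurableSet_run_mem_good (hEvent : ∀ i, MeasurableSet (I.event i))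
    (hRes : ∀ S, NullMeasurableSet {σ | I.res σ = S} (Measure.pi μ))
    (hX : ∀ t k, Measurable (X t k)) (hLaw : ∀ t k, P.map (X t k) = μ k)
    (hIndep : iIndepFun (fun p : ℕ × Fin n => X p.1 p.2) P) (t : ℕ) :
    NullMeasurableSet {ω | I.run (fun t k => X t k ω) t ∈ I.good} P :=
  (exists_measure_run_mem_inter_good hEvent hRes hX hLaw hIndep t).1.nullMeasurableSet_preimage
    (measurableSet_good hEvent)

theorem aemeasurable_output (hEvent : ∀ i, MeasurableSet (I.event i))
    (hRes : ∀ S, NullMeasurableSet {σ | I.res σ = S} (Measure.pi μ))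
    (hX : ∀ t k, Measurable (X t k)) (hLaw : ∀ t k, P.map (X t k) = μ k)
    (hIndep : iIndepFun (fun p : ℕ × Fin n => X p.1 p.2) P) :
    AEMeasurable (fun ω => I.output fun t k => X t k ω)
      (P.restrict {ω | I.Halts fun t k => X t k ω}) := by
  rw [setOf_halts_eq_iUnion, aemeasurable_iUnion_iff]
  intro t
  refine (exists_measure_run_mem_inter_good hEvent hRes hX hLaw hIndep t).1.restrict.congr ?_
  filter_upwards [ae_restrict_mem₀
    (nullMeasurableSet_run_mem_good hEvent hRes hX hLaw hIndep t)] with ω hω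
  exact (output_eq_run (mem_good_iff.1 hω)).symm

end VariableFramework

/-! ### Normalisation -/

theorem mainTheorem1 {n m : ℕ} {D : Fin n → Type*} [∀ k, MeasurableSpace (D k)]
    (μ : ∀ k, MeasureTheory.Measure (D k)) [∀ k, MeasureTheory.IsProbabilityMeasure (μ k)]
    (I : VariableFramework D m)
    -- the bad events are events, and the resampling set is a random variable
    (hEvent : ∀ i, MeasurableSet (I.event i))
    (hRes : ∀ S : Finset (Fin m),
      MeasureTheory.NullMeasurableSet {σ | I.res σ = S} (MeasureTheory.Measure.pi μ))
    {Ω : Type*} [MeasurableSpace Ω]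
    (P : MeasureTheory.Measure Ω) [MeasureTheory.IsProbabilityMeasure P]
    -- `X t k` is the sample of variable `k` for round `t`; all samples are independent
    (X : ℕ → ∀ k, Ω → D k) (hX : ∀ t k, Measurable (X t k))
    (hLaw : ∀ t k, P.map (X t k) = μ k)
    (hIndep : ProbabilityTheory.iIndepFun (fun p : ℕ × Fin n => X p.1 p.2) P) :
    MeasureTheory.NullMeasurableSet {ω | I.Halts fun t k => X t k ω} P ∧
    (P {ω | I.Halts fun t k => X t k ω} ≠ 0 →
      MeasureTheory.Measure.pi μ I.good ≠ 0 ∧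
      AEMeasurable (fun ω => I.output fun t k => X t k ω)
        (ProbabilityTheory.cond P {ω | I.Halts fun t k => X t k ω}) ∧
      (ProbabilityTheory.cond P {ω | I.Halts fun t k => X t k ω}).map
          (fun ω => I.output fun t k => X t k ω) =
        ProbabilityTheory.cond (MeasureTheory.Measure.pi μ) I.good) := by
  have hH : MeasureTheory.NullMeasurableSet {ω | I.Halts fun t k => X t k ω} P := by
    rw [VariableFramework.setOf_halts_eq_iUnion]
    exact MeasureTheory.NullMeasurableSet.iUnion fun t =>
      VariableFramework.nullMeasurableSet_run_mem_good hEvent hRes hX hLaw hIndep t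
  have hout := VariableFramework.aemeasurable_output hEvent hRes hX hLaw hIndep
  obtain ⟨c, hc⟩ :=
    VariableFramework.exists_measure_halts_and_output_mem hEvent hRes hX hLaw hIndep
  have hPH : P {ω | I.Halts fun t k => X t k ω} = c * MeasureTheory.Measure.pi μ I.good := by
    simpa using hc Set.univ MeasurableSet.univ
  refine ⟨hH, fun hpos => ?_⟩
  have hgood : MeasureTheory.Measure.pi μ I.good ≠ 0 := fun h => hpos (by rw [hPH, h, mul_zero])
  have hc0 : c ≠ 0 := fun h => hpos (by rw [hPH, h, zero_mul])
  -- Cancelling `c` needs it finite; an infinite `c` would give halting infinite probability.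
  have hctop : c ≠ ⊤ := fun h =>
    MeasureTheory.measure_ne_top P _ (hPH.trans (by rw [h, ENNReal.top_mul hgood]))
  refine ⟨hgood, hout.smul_measure _, ?_⟩
  ext B hB
  rw [ProbabilityTheory.cond, ProbabilityTheory.cond, MeasureTheory.Measure.map_smul,
    MeasureTheory.Measure.smul_apply, MeasureTheory.Measure.smul_apply,
    MeasureTheory.Measure.map_apply_of_aemeasurable hout hB,
    MeasureTheory.Measure.restrict_apply₀' hH, MeasureTheory.Measure.restrict_apply hB,
    Set.inter_comm]
  have hB' := hc B hB
  rw [Set.ofPred_and] at hB'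
  rw [show (fun ω => I.output fun t k => X t k ω) ⁻¹' B =
    {ω | (I.output fun t k => X t k ω) ∈ B} from rfl, hB', hPH, smul_eq_mul, smul_eq_mul,
    ENNReal.mul_inv (Or.inl hc0) (Or.inl hctop), mul_comm c⁻¹, mul_assoc, ← mul_assoc c⁻¹,
    ENNReal.inv_mul_cancel hc0 hctop, one_mul]
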